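/- There is a universal constant $c>0$ such that the following holds. Let $n\ge 1$, let $\Omega\subset\mathbb{R}^n$ be an orthotope, i.e. the image of a box $[-a_1,a_1]\times\cdots\times[-a_n,a_n]$ with all $a_i>0$ under an isometry of $\mathbb{R}^n$, and let \[0=\mu_0(\Omega)<\mu_1(\Omega)\le\mu_2(\Omega)\le\cdots\] be the eigenvalues of the Neumann Laplacian on (the interior of) $\Omega$, repeated according to multiplicity. Then for all integers $k\ge l\ge 1$ there are an integer $k'\le k$ and a convex partition $\{\Omega_i\}_{i=1}^{k'}$ of $\Omega$, that is, convex sets $\Omega_i$ with non-empty interior such that $\Omega=\bigcup_{i=1}^{k'}\Omega_i$ and $\operatorname{vol}(\Omega_i\cap\Omega_j)=0$ for $i\ne j$, such that \[\operatorname{Diam}\Omega_i\le c\,n^{3/2}\Big(\frac{l}{k}\Big)^{1/n}\frac{1}{\sqrt{\mu_l(\Omega)}}\qquad\text{for all } i=1,\dots,k'.\] -/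

import Mathlib

open MeasureTheory
open scoped ContDiff

/-- A (closed, non-degenerate) orthotope in `ℝⁿ`, in arbitrary position: a box with centre `p`,
edges parallel to the vectors of an orthonormal basis `b`, and edge lengths `2 * a i > 0`. -/
def IsOrthotope {n : ℕ} (Ω : Set (EuclideanSpace ℝ (Fin n))) : Prop :=
  ∃ (b : OrthonormalBasis (Fin n) ℝ (EuclideanSpace ℝ (Fin n)))
    (p : EuclideanSpace ℝ (Fin n)) (a : Fin n → ℝ),
    (∀ i, 0 < a i) ∧ Ω = {x | ∀ i, |inner ℝ (b i) (x - p)| ≤ a i}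

/-- A convex partition of `Ω` into `m` pieces: the pieces are convex with non-empty interior,
cover `Ω` exactly, and overlap pairwise in sets of Lebesgue measure zero. -/
structure IsConvexPartition {n m : ℕ} (Ω : Set (EuclideanSpace ℝ (Fin n)))
    (P : Fin m → Set (EuclideanSpace ℝ (Fin n))) : Prop where
  convex : ∀ i, Convex ℝ (P i)
  interior_nonempty : ∀ i, (interior (P i)).Nonempty
  iUnion_eq : ⋃ i, P i = Ω
  volume_inter : ∀ i j, i ≠ j → volume (P i ∩ P j) = 0

/-- The real Hilbert space `L²(U)`. -/
abbrev L2 {n : ℕ} (U : Set (EuclideanSpace ℝ (Fin n))) : Type :=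
  Lp ℝ 2 (volume.restrict U)

/-- The real Hilbert space `L²(U; ℝⁿ)` of square integrable vector fields. -/
abbrev L2Field {n : ℕ} (U : Set (EuclideanSpace ℝ (Fin n))) : Type :=
  Lp (EuclideanSpace ℝ (Fin n)) 2 (volume.restrict U)

/-- `g` is the weak gradient of `u` on the open set `U`, tested against `C_c^∞(U)`. Thus `u`
belongs to the Sobolev space `H¹(U)` exactly if it has a weak gradient `g : L2Field U`. -/
def HasWeakGradient {n : ℕ} (U : Set (EuclideanSpace ℝ (Fin n))) (u : L2 U) (g : L2Field U) :
    Prop :=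
  ∀ φ : EuclideanSpace ℝ (Fin n) → ℝ, ContDiff ℝ ∞ φ → HasCompactSupport φ → tsupport φ ⊆ U →
    ∀ w : EuclideanSpace ℝ (Fin n),
      ∫ x in U, u x * fderiv ℝ φ x w = -∫ x in U, inner ℝ (g x) w * φ x

/-- `u` is an eigenfunction of the Neumann Laplacian on the open set `U` with eigenvalue `lam`:
`u ∈ H¹(U)`, `u ≠ 0`, and `∫_U ⟨∇u, ∇v⟩ = lam * ∫_U u v` for all `v ∈ H¹(U)`. The two integrals
are the inner products of `L²(U; ℝⁿ)` and of `L²(U)`. -/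
def IsNeumannEigenfunction {n : ℕ} (U : Set (EuclideanSpace ℝ (Fin n))) (lam : ℝ) (u : L2 U) :
    Prop :=
  u ≠ 0 ∧ ∃ g : L2Field U, HasWeakGradient U u g ∧
    ∀ (v : L2 U) (h : L2Field U), HasWeakGradient U v h → inner ℝ g h = lam * inner ℝ u v

/-- The Neumann eigenvalue `μ_k` of the open set `U`, in the numbering `μ_0 ≤ μ_1 ≤ μ_2 ≤ ⋯` with
repetition by multiplicity: the least `t` such that there are `k + 1` linearly independent
eigenfunctions with eigenvalues at most `t`. -/
noncomputable def neumannEigenvalue {n : ℕ} (U : Set (EuclideanSpace ℝ (Fin n))) (k : ℕ) : ℝ :=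
  sInf {t : ℝ | ∃ u : Fin (k + 1) → L2 U, LinearIndependent ℝ u ∧
    ∀ i, ∃ lam ≤ t, IsNeumannEigenfunction U lam (u i)}

/-! In normalised coordinates the products of cosines `∏ cos (π mᵢ tᵢ)` are Neumann eigenfunctions
with eigenvalue `∑ (π mᵢ / (2 aᵢ))²`. All frequencies with `mᵢ ≤ 2 aᵢ s` have eigenvalue at most `n
(π s)²`; if this is below `μ_l`, there are at most `l` of them, so `∏ (⌊2 aᵢ s⌋ + 1) ≤ l`
(`prod_floor_add_one_le`). Take `s` of order `√μ_l / √n` and `q = (k / l)^(1/n)`, and cut the `i`-th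
edge into `⌈aᵢ s q⌉ ≤ q (⌊2 aᵢ s⌋ + 1)` equal parts. The grid has at most `qⁿ l = k` cells, each
with edges at most `2 / (s q)`, hence diameter at most `2 √n / (s q)`.

Two analytic facts support this. The cosines satisfy the weak equation against all of `H¹`, although
weak gradients are tested only against compactly supported functions (`integral_mul_prodFn_deriv`).
And `μ_l > 0` for `l ≥ 1` (`neumannEigenvalue_pos`), which rests on completeness of the cosines, by
Stone–Weierstrass (`eq_zero_of_inner_cosLp_eq_zero`). -/

namespace Orthotope

/-! ### Normalised coordinates on the box and product functions. -/

variable {n : ℕ} (b : OrthonormalBasis (Fin n) ℝ (EuclideanSpace ℝ (Fin n)))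
  (p : EuclideanSpace ℝ (Fin n)) (a : Fin n → ℝ)

/-- The closed orthotope with centre `p`, axes `b` and half edge lengths `a`. -/
def box : Set (EuclideanSpace ℝ (Fin n)) := {x | ∀ i, |inner ℝ (b i) (x - p)| ≤ a i}

/-- The `i`-th coordinate along the box, normalised to run over `[0, 1]`. -/
noncomputable def coord (i : Fin n) (x : EuclideanSpace ℝ (Fin n)) : ℝ :=
  (inner ℝ (b i) (x - p) + a i) / (2 * a i)

/-- The point with prescribed normalised coordinates. -/
noncomputable def point (t : Fin n → ℝ) : EuclideanSpace ℝ (Fin n) :=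
  p + ∑ i, (2 * a i * t i - a i) • b i

/-- A product of functions of the normalised coordinates. -/
noncomputable def prodFn (g : Fin n → ℝ → ℝ) (x : EuclideanSpace ℝ (Fin n)) : ℝ :=
  ∏ i, g i (coord b p a i x)

variable {b p a}

theorem coord_point (ha : ∀ i, 0 < a i) (t : Fin n → ℝ) (i : Fin n) :
    coord b p a i (point b p a t) = t i := by
  have h : inner ℝ (b i) (∑ j, (2 * a j * t j - a j) • b j) = 2 * a i * t i - a i := by
    simp [inner_sum, inner_smul_right, b.inner_eq_ite]
  have := ha i
  rw [coord, point, add_sub_cancel_left, h]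
  field_simp
  ring

theorem inner_sub_eq_coord (ha : ∀ i, 0 < a i) (i : Fin n) (x y : EuclideanSpace ℝ (Fin n)) :
    inner ℝ (b i) (x - y) = 2 * a i * (coord b p a i x - coord b p a i y) := by
  have := ha i
  have h : x - y = (x - p) - (y - p) := by abel
  rw [h, inner_sub_right, coord, coord]
  field_simp
  ring

theorem coord_injective (ha : ∀ i, 0 < a i) {x y : EuclideanSpace ℝ (Fin n)}
    (h : ∀ i, coord b p a i x = coord b p a i y) : x = y := by
  rw [← sub_eq_zero]
  refine InnerProductSpace.ext_inner_left_basis b.toBasis fun i => ?_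
  simp [inner_sub_eq_coord (p := p) ha, h i]

theorem point_coord (ha : ∀ i, 0 < a i) (x : EuclideanSpace ℝ (Fin n)) :
    point b p a (fun i => coord b p a i x) = x :=
  coord_injective ha fun i => coord_point ha _ i

theorem continuous_point : Continuous (point b p a) := by
  unfold point; fun_prop

theorem hasFDerivAt_coord (i : Fin n) (x : EuclideanSpace ℝ (Fin n)) :
    HasFDerivAt (coord b p a i) ((2 * a i)⁻¹ • innerSL ℝ (b i)) x := by
  have h1 : HasFDerivAt (fun x => innerSL ℝ (b i) (x - p)) (innerSL ℝ (b i)) x := by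
    have := (innerSL ℝ (b i)).hasFDerivAt.comp x ((hasFDerivAt_id x).sub_const p)
    rwa [ContinuousLinearMap.comp_id] at this
  have h2 := (h1.add_const (a i)).const_mul (2 * a i)⁻¹
  refine h2.congr_of_eventuallyEq (Filter.Eventually.of_forall fun y => ?_)
  simp [coord, div_eq_inv_mul]

theorem contDiff_coord (i : Fin n) : ContDiff ℝ ∞ (coord b p a i) := by
  unfold coord
  exact ((contDiff_const.inner ℝ (contDiff_id.sub contDiff_const)).add contDiff_const).div_const _

theorem continuous_coord (i : Fin n) : Continuous (coord b p a i) :=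
  (contDiff_coord i).continuous

/-- The coordinates, as a homeomorphism onto `ℝⁿ` with its product structure. -/
noncomputable def coordHomeomorph (b : OrthonormalBasis (Fin n) ℝ (EuclideanSpace ℝ (Fin n)))
    (p : EuclideanSpace ℝ (Fin n)) (ha : ∀ i, 0 < a i) :
    EuclideanSpace ℝ (Fin n) ≃ₜ (Fin n → ℝ) where
  toFun x i := coord b p a i x
  invFun := point b p a
  left_inv := point_coord ha
  right_inv t := funext (coord_point ha t)
  continuous_toFun := continuous_pi continuous_coord
  continuous_invFun := continuous_point

theorem mem_box_iff (ha : ∀ i, 0 < a i) {x : EuclideanSpace ℝ (Fin n)} :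
    x ∈ box b p a ↔ ∀ i, coord b p a i x ∈ Set.Icc (0 : ℝ) 1 := by
  refine forall_congr' fun i => ?_
  have := ha i
  rw [abs_le, Set.mem_Icc, coord, le_div_iff₀ (by linarith), div_le_iff₀ (by linarith)]
  constructor <;> rintro ⟨h1, h2⟩ <;> constructor <;> linarith

theorem box_eq_preimage (ha : ∀ i, 0 < a i) :
    box b p a = coordHomeomorph b p ha ⁻¹' Set.univ.pi fun _ => Set.Icc (0 : ℝ) 1 := by
  ext x
  simp only [mem_box_iff ha, Set.mem_preimage, Set.mem_univ_pi]
  rfl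

theorem mem_interior_box_iff (ha : ∀ i, 0 < a i) {x : EuclideanSpace ℝ (Fin n)} :
    x ∈ interior (box b p a) ↔ ∀ i, coord b p a i x ∈ Set.Ioo (0 : ℝ) 1 := by
  rw [box_eq_preimage ha, ← Homeomorph.preimage_interior, interior_pi_set Set.finite_univ]
  simp only [interior_Icc, Set.mem_preimage, Set.mem_univ_pi]
  rfl

theorem isCompact_box (ha : ∀ i, 0 < a i) : IsCompact (box b p a) := by
  rw [box_eq_preimage ha, Homeomorph.isCompact_preimage]
  exact isCompact_univ_pi fun _ => isCompact_Icc

theorem volume_interior_box_lt_top (ha : ∀ i, 0 < a i) :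
    volume (interior (box b p a)) < ⊤ :=
  (measure_mono interior_subset).trans_lt (isCompact_box ha).measure_lt_top

theorem contDiff_prodFn {g : Fin n → ℝ → ℝ} (hg : ∀ i, ContDiff ℝ ∞ (g i)) :
    ContDiff ℝ ∞ (prodFn b p a g) :=
  contDiff_prod fun i _ => (hg i).comp (contDiff_coord i)

theorem prodFn_update (g : Fin n → ℝ → ℝ) (i : Fin n) (f : ℝ → ℝ)
    (x : EuclideanSpace ℝ (Fin n)) :
    prodFn b p a (Function.update g i f) x =
      f (coord b p a i x) * ∏ j ∈ Finset.univ.erase i, g j (coord b p a j x) := by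
  rw [prodFn, ← Finset.mul_prod_erase _ _ (Finset.mem_univ i), Function.update_self]
  congr 1
  refine Finset.prod_congr rfl fun j hj => ?_
  rw [Function.update_of_ne (Finset.ne_of_mem_erase hj)]

theorem prodFn_eq_mul (g : Fin n → ℝ → ℝ) (i : Fin n) (x : EuclideanSpace ℝ (Fin n)) :
    prodFn b p a g x =
      g i (coord b p a i x) * ∏ j ∈ Finset.univ.erase i, g j (coord b p a j x) := by
  rw [← prodFn_update, Function.update_eq_self]

theorem fderiv_prodFn {g : Fin n → ℝ → ℝ} (hg : ∀ i, Differentiable ℝ (g i)) (i : Fin n)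
    (x : EuclideanSpace ℝ (Fin n)) :
    fderiv ℝ (prodFn b p a g) x (b i) =
      (2 * a i)⁻¹ * prodFn b p a (Function.update g i (deriv (g i))) x := by
  have h : ∀ j ∈ Finset.univ, HasFDerivAt (fun x => g j (coord b p a j x))
      (deriv (g j) (coord b p a j x) • ((2 * a j)⁻¹ • innerSL ℝ (b j))) x := fun j _ =>
    (hg j _).hasDerivAt.comp_hasFDerivAt x (hasFDerivAt_coord j x)
  have h2 := HasFDerivAt.finsetProd h
  change HasFDerivAt (prodFn b p a g) _ x at h2
  rw [h2.fderiv, prodFn_update]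
  simp only [sum_apply, smul_apply, innerSL_apply_apply,
    b.inner_eq_ite, smul_eq_mul, mul_ite, mul_one, mul_zero, Finset.sum_ite_eq',
    Finset.mem_univ, if_true]
  ring

end Orthotope

/-! ### Cutoffs and integration by parts without boundary term. -/

namespace Orthotope

open Filter Topology

/-- Smooth cutoff functions of compact support in `(0, 1)`, exhausting it as `M → ∞`. -/
noncomputable def cutoff (M : ℕ) (t : ℝ) : ℝ := Real.smoothTransition (M * (t * (1 - t)) - 1)

theorem contDiff_cutoff (M : ℕ) : ContDiff ℝ ∞ (cutoff M) :=
  Real.smoothTransition.contDiff.comp (by fun_prop)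

theorem cutoff_eq_zero {M : ℕ} {t : ℝ} (h : M * (t * (1 - t)) ≤ 1) : cutoff M t = 0 :=
  Real.smoothTransition.zero_of_nonpos (by linarith)

theorem abs_cutoff_le_one (M : ℕ) (t : ℝ) : |cutoff M t| ≤ 1 := by
  rw [cutoff, abs_of_nonneg (Real.smoothTransition.nonneg _)]
  exact Real.smoothTransition.le_one _

theorem cutoff_eventuallyEq_one {t : ℝ} (ht : t ∈ Set.Ioo (0 : ℝ) 1) :
    ∀ᶠ M : ℕ in atTop, cutoff M =ᶠ[𝓝 t] 1 := by
  have h0 : 0 < t * (1 - t) := mul_pos ht.1 (sub_pos.2 ht.2)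
  have h1 : Tendsto (fun M : ℕ => (M : ℝ) * (t * (1 - t))) atTop atTop :=
    tendsto_natCast_atTop_atTop.atTop_mul_const h0
  filter_upwards [h1.eventually_gt_atTop 2] with M hM
  have hc : Continuous fun s : ℝ => (M : ℝ) * (s * (1 - s)) := by fun_prop
  have h2 : ∀ᶠ s in 𝓝 t, 2 < (M : ℝ) * (s * (1 - s)) := hc.continuousAt.eventually_const_lt hM
  filter_upwards [h2] with s hs
  exact Real.smoothTransition.one_of_one_le (by linarith)

theorem deriv_smoothTransition_eq_zero {y : ℝ} (hy : y ∉ Set.Icc (0 : ℝ) 1) :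
    deriv Real.smoothTransition y = 0 := by
  rw [Set.mem_Icc, not_and_or, not_le, not_le] at hy
  rcases hy with hy | hy
  · have : Real.smoothTransition =ᶠ[𝓝 y] fun _ => (0 : ℝ) := by
      filter_upwards [Iio_mem_nhds hy] with z hz
      exact Real.smoothTransition.zero_of_nonpos (le_of_lt hz)
    rw [this.deriv_eq, deriv_const]
  · have : Real.smoothTransition =ᶠ[𝓝 y] fun _ => (1 : ℝ) := by
      filter_upwards [Ioi_mem_nhds hy] with z hz
      exact Real.smoothTransition.one_of_one_le (le_of_lt hz)
    rw [this.deriv_eq, deriv_const]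

theorem exists_abs_deriv_smoothTransition_le :
    ∃ K, ∀ y, |deriv Real.smoothTransition y| ≤ K := by
  have hc : Continuous (deriv Real.smoothTransition) :=
    (Real.smoothTransition.contDiff (n := 1)).continuous_deriv le_rfl
  have hs : HasCompactSupport (deriv Real.smoothTransition) :=
    HasCompactSupport.intro isCompact_Icc fun _ => deriv_smoothTransition_eq_zero
  exact hs.exists_bound_of_continuous hc

/-- The derivative is of order `M`, but it lives where `1 ≤ M t (1 - t) ≤ 2`, so the weight `t (1 -
t)` compensates uniformly in `M`. -/
theorem exists_abs_deriv_cutoff_mul_le :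
    ∃ K, ∀ (M : ℕ), ∀ t ∈ Set.Ioo (0 : ℝ) 1, |deriv (cutoff M) t| * (t * (1 - t)) ≤ K := by
  obtain ⟨K, hK⟩ := exists_abs_deriv_smoothTransition_le
  have hK0 : 0 ≤ K := (abs_nonneg _).trans (hK 0)
  refine ⟨2 * K, fun M t ht => ?_⟩
  set y : ℝ := M * (t * (1 - t)) - 1 with hy
  have h1 : HasDerivAt (fun t : ℝ => (M : ℝ) * (t * (1 - t)) - 1) (M * (1 - 2 * t)) t := by
    have := (((hasDerivAt_id' t).fun_mul ((hasDerivAt_id' t).const_sub 1)).const_mul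
      (M : ℝ)).sub_const 1
    exact this.congr_deriv (by ring)
  have h2 : HasDerivAt (cutoff M) (deriv Real.smoothTransition y * (M * (1 - 2 * t))) t :=
    ((Real.smoothTransition.contDiff (n := 1)).differentiable one_ne_zero y).hasDerivAt.comp t h1
  have h0 : 0 ≤ t * (1 - t) := (mul_pos ht.1 (sub_pos.2 ht.2)).le
  rw [h2.deriv]
  by_cases hyI : y ∈ Set.Icc (0 : ℝ) 1
  · have h3 : |1 - 2 * t| ≤ 1 := abs_le.2 ⟨by linarith [ht.2], by linarith [ht.1]⟩
    have h4 : (M : ℝ) * (t * (1 - t)) ≤ 2 := by linarith [hyI.2]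
    have h5 : 0 ≤ (M : ℝ) * (t * (1 - t)) := by positivity
    calc |deriv Real.smoothTransition y * (M * (1 - 2 * t))| * (t * (1 - t))
        = |deriv Real.smoothTransition y| * |1 - 2 * t| * (M * (t * (1 - t))) := by
          rw [abs_mul, abs_mul, Nat.abs_cast]; ring
      _ ≤ K * 1 * 2 := by gcongr; exact hK y
      _ = 2 * K := by ring
  · rw [deriv_smoothTransition_eq_zero hyI]
    simpa using hK0

variable {n : ℕ} {b : OrthonormalBasis (Fin n) ℝ (EuclideanSpace ℝ (Fin n))}
  {p : EuclideanSpace ℝ (Fin n)} {a : Fin n → ℝ}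

theorem continuous_prodFn {g : Fin n → ℝ → ℝ} (hg : ∀ i, Continuous (g i)) :
    Continuous (prodFn b p a g) :=
  continuous_finsetProd _ fun i _ => (hg i).comp (continuous_coord i)

theorem tendsto_integral_mul_prodFn (ha : ∀ i, 0 < a i) {v : EuclideanSpace ℝ (Fin n) → ℝ}
    (hv : IntegrableOn v (interior (box b p a))) {G : ℕ → Fin n → ℝ → ℝ} {g : Fin n → ℝ → ℝ}
    (hG : ∀ M j, Continuous (G M j))
    (hb : ∀ j, ∃ B, ∀ M, ∀ t ∈ Set.Ioo (0 : ℝ) 1, |G M j t| ≤ B)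
    (hlim : ∀ j, ∀ t ∈ Set.Ioo (0 : ℝ) 1, ∀ᶠ M in atTop, G M j t = g j t) :
    Tendsto (fun M => ∫ x in interior (box b p a), v x * prodFn b p a (G M) x) atTop
      (𝓝 (∫ x in interior (box b p a), v x * prodFn b p a g x)) := by
  choose B hB using hb
  refine tendsto_integral_of_dominated_convergence (fun x => |v x| * ∏ j, B j) ?_ ?_ ?_ ?_
  · exact fun M => hv.aestronglyMeasurable.mul (continuous_prodFn (hG M)).aestronglyMeasurable
  · exact hv.abs.mul_const _
  · intro M
    filter_upwards [ae_restrict_mem isOpen_interior.measurableSet] with x hx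
    rw [mem_interior_box_iff ha] at hx
    rw [Real.norm_eq_abs, abs_mul, prodFn, Finset.abs_prod]
    gcongr with j
    exact hB j M _ (hx j)
  · filter_upwards [ae_restrict_mem isOpen_interior.measurableSet] with x hx
    rw [mem_interior_box_iff ha] at hx
    refine tendsto_const_nhds.congr' ?_
    filter_upwards [eventually_all.2 fun j => hlim j _ (hx j)] with M hM
    simp only [prodFn, hM]

theorem exists_bound_Ioo {f : ℝ → ℝ} (hf : Continuous f) :
    ∃ B, ∀ t ∈ Set.Ioo (0 : ℝ) 1, |f t| ≤ B := by
  obtain ⟨B, hB⟩ := isCompact_Icc.exists_bound_of_continuousOn (s := Set.Icc (0 : ℝ) 1)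
    hf.continuousOn
  exact ⟨B, fun t ht => hB t (Set.Ioo_subset_Icc_self ht)⟩

theorem tsupport_prodFn_cutoff_subset (M : ℕ) (f : Fin n → ℝ → ℝ) :
    tsupport (prodFn b p a fun j t => cutoff M t * f j t) ⊆
      {x | ∀ j, 1 ≤ M * (coord b p a j x * (1 - coord b p a j x))} := by
  refine closure_minimal (fun x hx j => ?_) ?_
  · by_contra h
    refine hx (Finset.prod_eq_zero (Finset.mem_univ j) ?_)
    simp only [cutoff_eq_zero (not_le.1 h).le, zero_mul]
  · simp only [Set.ofPred_forall]
    refine isClosed_iInter fun j => isClosed_le continuous_const ?_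
    have := continuous_coord (b := b) (p := p) (a := a) j
    fun_prop

theorem mem_Ioo_of_one_le_mul {M : ℕ} {t : ℝ} (h : 1 ≤ M * (t * (1 - t))) :
    t ∈ Set.Ioo (0 : ℝ) 1 := by
  have h1 : 0 < t * (1 - t) := by
    by_contra h2
    have := mul_nonpos_of_nonneg_of_nonpos (Nat.cast_nonneg (α := ℝ) M) (not_lt.1 h2)
    linarith
  constructor <;> nlinarith

/-- Integration by parts on a box against a product function whose `i`-th factor vanishes at
both ends: there is no boundary term in the direction `b i`. -/
theorem integral_mul_prodFn_deriv (ha : ∀ i, 0 < a i) {v : L2 (interior (box b p a))}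
    {h : L2Field (interior (box b p a))} (hvh : HasWeakGradient (interior (box b p a)) v h)
    {f : Fin n → ℝ → ℝ} (hf : ∀ j, ContDiff ℝ ∞ (f j)) (i : Fin n) {C : ℝ}
    (hC : ∀ t ∈ Set.Ioo (0 : ℝ) 1, |f i t| ≤ C * (t * (1 - t))) :
    ∫ x in interior (box b p a), v x * prodFn b p a (Function.update f i (deriv (f i))) x =
      -(2 * a i) * ∫ x in interior (box b p a), inner ℝ (h x) (b i) * prodFn b p a f x := by
  have hfin : IsFiniteMeasure (volume.restrict (interior (box b p a))) :=
    ⟨by simpa using volume_interior_box_lt_top ha⟩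
  have hv : IntegrableOn v (interior (box b p a)) := (Lp.memLp v).integrable (by norm_num)
  have hh : IntegrableOn (fun x => inner ℝ (h x) (b i)) (interior (box b p a)) :=
    ((Lp.memLp h).integrable (by norm_num)).inner_const (b i)
  have hsm : ∀ M j, ContDiff ℝ ∞ fun t => cutoff M t * f j t := fun M j =>
    (contDiff_cutoff M).mul (hf j)
  have hbd : ∀ j, ∃ B, ∀ M, ∀ t ∈ Set.Ioo (0 : ℝ) 1, |cutoff M t * f j t| ≤ B := by
    intro j
    obtain ⟨B, hB⟩ := exists_bound_Ioo (hf j).continuous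
    refine ⟨B, fun M t ht => ?_⟩
    rw [abs_mul]
    exact (mul_le_of_le_one_left (abs_nonneg _) (abs_cutoff_le_one M t)).trans (hB t ht)
  have hd : ∀ M t, deriv (fun t => cutoff M t * f i t) t =
      deriv (cutoff M) t * f i t + cutoff M t * deriv (f i) t := fun M t =>
    deriv_fun_mul ((contDiff_cutoff M).differentiable (by simp) t)
      ((hf i).differentiable (by simp) t)
  have hlim1 := tendsto_integral_mul_prodFn ha hh (G := fun M j t => cutoff M t * f j t)
    (g := f) (fun M j => (hsm M j).continuous) hbd (fun j t ht => by
      filter_upwards [cutoff_eventuallyEq_one ht] with M hM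
      rw [hM.self_of_nhds, Pi.one_apply, one_mul])
  -- Cut off in every direction, use the weak gradient, and let `M → ∞` on both sides by dominated
  -- convergence.
  have hlim2 := tendsto_integral_mul_prodFn ha hv
    (G := fun M => Function.update (fun j t => cutoff M t * f j t) i
      (deriv fun t => cutoff M t * f i t))
    (g := Function.update f i (deriv (f i))) ?_ ?_ ?_
  · have key : ∀ M, ∫ x in interior (box b p a), v x *
        prodFn b p a (Function.update (fun j t => cutoff M t * f j t) i
          (deriv fun t => cutoff M t * f i t)) x =
        -(2 * a i) * ∫ x in interior (box b p a), inner ℝ (h x) (b i) *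
          prodFn b p a (fun j t => cutoff M t * f j t) x := by
      intro M
      have hsub : tsupport (prodFn b p a fun j t => cutoff M t * f j t) ⊆
          interior (box b p a) := fun x hx =>
        (mem_interior_box_iff ha).2 fun j =>
          mem_Ioo_of_one_le_mul (tsupport_prodFn_cutoff_subset M f hx j)
      have := hvh _ (contDiff_prodFn (hsm M))
        ((isCompact_box ha).of_isClosed_subset (isClosed_tsupport _)
          (hsub.trans interior_subset)) hsub (b i)
      simp only [fderiv_prodFn fun j => (hsm M j).differentiable (by simp)] at this
      simp only [mul_left_comm _ (2 * a i)⁻¹, integral_const_mul] at this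
      have hai := ha i
      rw [inv_mul_eq_iff_eq_mul₀ (by positivity)] at this
      rw [this]
      ring
    simp only [key] at hlim2
    exact tendsto_nhds_unique hlim2 (hlim1.const_mul _)
  · intro M j
    rcases eq_or_ne j i with rfl | hj
    · rw [Function.update_self]
      exact (hsm M j).continuous_deriv (by simp)
    · rw [Function.update_of_ne hj]
      exact (hsm M j).continuous
  · intro j
    rcases eq_or_ne j i with rfl | hj
    · obtain ⟨K, hK⟩ := exists_abs_deriv_cutoff_mul_le
      obtain ⟨B, hB⟩ := exists_bound_Ioo ((hf j).continuous_deriv (by simp))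
      -- `C * K` bounds the term with the differentiated cutoff, where the vanishing of `f i` at the
      -- ends is needed; `B` bounds the other one.
      refine ⟨C * K + B, fun M t ht => ?_⟩
      have ht0 : 0 < t * (1 - t) := mul_pos ht.1 (sub_pos.2 ht.2)
      have hC0 : 0 ≤ C := nonneg_of_mul_nonneg_left ((abs_nonneg _).trans (hC t ht)) ht0
      simp only [Function.update_self, hd]
      refine (abs_add_le _ _).trans (add_le_add ?_ ?_)
      · rw [abs_mul]
        calc |deriv (cutoff M) t| * |f j t|
            ≤ |deriv (cutoff M) t| * (C * (t * (1 - t))) := by gcongr; exact hC t ht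
          _ = C * (|deriv (cutoff M) t| * (t * (1 - t))) := by ring
          _ ≤ C * K := by gcongr; exact hK M t ht
      · rw [abs_mul]
        exact (mul_le_of_le_one_left (abs_nonneg _) (abs_cutoff_le_one M t)).trans (hB t ht)
    · simpa only [Function.update_of_ne hj] using hbd j
  · intro j t ht
    filter_upwards [cutoff_eventuallyEq_one ht] with M hM
    rcases eq_or_ne j i with rfl | hj
    · simp only [Function.update_self, hd, hM.deriv_eq, hM.self_of_nhds]
      simp
    · simp only [Function.update_of_ne hj, hM.self_of_nhds, Pi.one_apply, one_mul]

end Orthotope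

/-! ### Cosine products are orthogonal Neumann eigenfunctions. -/

namespace Orthotope

open Filter Topology

variable {n : ℕ} {b : OrthonormalBasis (Fin n) ℝ (EuclideanSpace ℝ (Fin n))}
  {p : EuclideanSpace ℝ (Fin n)} {a : Fin n → ℝ}

theorem memLp_of_continuous (ha : ∀ i, 0 < a i) {F : Type*} [NormedAddCommGroup F]
    [SecondCountableTopology F] {f : EuclideanSpace ℝ (Fin n) → F} (hf : Continuous f) :
    MemLp f 2 (volume.restrict (interior (box b p a))) := by
  have hfin : IsFiniteMeasure (volume.restrict (interior (box b p a))) :=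
    ⟨by simpa using volume_interior_box_lt_top ha⟩
  obtain ⟨C, hC⟩ := (isCompact_box (b := b) (p := p) ha).exists_bound_of_continuousOn
    hf.continuousOn
  refine MemLp.of_bound hf.aestronglyMeasurable C ?_
  filter_upwards [ae_restrict_mem isOpen_interior.measurableSet] with x hx
  exact hC x (interior_subset hx)

theorem continuous_gradient {f : EuclideanSpace ℝ (Fin n) → ℝ} (hf : ContDiff ℝ ∞ f) :
    Continuous (gradient f) :=
  (InnerProductSpace.toDual ℝ _).symm.continuous.comp (hf.continuous_fderiv (by simp))

theorem inner_gradient (f : EuclideanSpace ℝ (Fin n) → ℝ) (x w : EuclideanSpace ℝ (Fin n)) :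
    inner ℝ (gradient f x) w = fderiv ℝ f x w :=
  InnerProductSpace.toDual_symm_apply

/-- The test function has compact support in the open box, so both integrals extend to the whole
space and `f` needs no boundary condition. -/
theorem hasWeakGradient_of_contDiff (ha : ∀ i, 0 < a i) {f : EuclideanSpace ℝ (Fin n) → ℝ}
    (hf : ContDiff ℝ ∞ f) :
    HasWeakGradient (interior (box b p a)) ((memLp_of_continuous ha hf.continuous).toLp f)
      ((memLp_of_continuous ha (continuous_gradient hf)).toLp (gradient f)) := by
  intro φ hφ hφc hφU w
  have hfw : Continuous fun x => fderiv ℝ f x w :=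
    (hf.continuous_fderiv (by simp)).clm_apply continuous_const
  have hφw : Continuous fun x => fderiv ℝ φ x w :=
    (hφ.continuous_fderiv (by simp)).clm_apply continuous_const
  have hφwc : HasCompactSupport fun x => fderiv ℝ φ x w := hφc.fderiv_apply ℝ w
  have h1 : ∫ x in interior (box b p a),
      (memLp_of_continuous (b := b) (p := p) ha hf.continuous).toLp f x * fderiv ℝ φ x w =
      ∫ x, f x * fderiv ℝ φ x w := by
    refine Eq.trans ?_ (setIntegral_eq_integral_of_forall_compl_eq_zero
      (s := interior (box b p a)) fun x hx => ?_)
    · refine integral_congr_ae ?_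
      filter_upwards [(memLp_of_continuous (b := b) (p := p) ha hf.continuous).coeFn_toLp]
        with x hx
      rw [hx]
    · have : fderiv ℝ φ x = 0 :=
        Function.notMem_support.1 fun h => hx (hφU (support_fderiv_subset ℝ h))
      simp [this]
  have h2 : ∫ x in interior (box b p a),
      inner ℝ ((memLp_of_continuous (b := b) (p := p) ha (continuous_gradient hf)).toLp
        (gradient f) x) w * φ x =
      ∫ x, fderiv ℝ f x w * φ x := by
    refine Eq.trans ?_ (setIntegral_eq_integral_of_forall_compl_eq_zero
      (s := interior (box b p a)) fun x hx => ?_)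
    · refine integral_congr_ae ?_
      filter_upwards [(memLp_of_continuous (b := b) (p := p) ha
        (continuous_gradient hf)).coeFn_toLp] with x hx
      rw [hx, inner_gradient]
    · rw [image_eq_zero_of_notMem_tsupport fun h => hx (hφU h), mul_zero]
  rw [h1, h2]
  refine integral_mul_fderiv_eq_neg_fderiv_mul_of_integrable ?_ ?_ ?_ ?_ ?_
  · exact (hfw.mul hφ.continuous).integrable_of_hasCompactSupport hφc.mul_left
  · exact (hf.continuous.mul hφw).integrable_of_hasCompactSupport hφwc.mul_left
  · exact (hf.continuous.mul hφ.continuous).integrable_of_hasCompactSupport hφc.mul_left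
  · exact fun x _ => hf.differentiable (by simp) x
  · exact fun x _ => hφ.differentiable (by simp) x

/-- The one-dimensional Neumann eigenfunctions `cos (π m t)` of the unit interval. -/
noncomputable def cosFn (m : Fin n → ℤ) (j : Fin n) (t : ℝ) : ℝ := Real.cos (Real.pi * m j * t)

theorem contDiff_cosFn (m : Fin n → ℤ) (j : Fin n) : ContDiff ℝ ∞ (cosFn m j) :=
  Real.contDiff_cos.comp (by fun_prop)

theorem deriv_cosFn (m : Fin n → ℤ) (j : Fin n) :
    deriv (cosFn m j) = fun t => -(Real.pi * m j) * Real.sin (Real.pi * m j * t) := by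
  funext t
  have h : HasDerivAt (fun t : ℝ => Real.pi * m j * t) (Real.pi * m j) t := by
    simpa using (hasDerivAt_id t).const_mul (Real.pi * m j)
  have h2 := h.cos
  change HasDerivAt (cosFn m j) _ t at h2
  rw [h2.deriv]
  ring

theorem deriv_deriv_cosFn (m : Fin n → ℤ) (j : Fin n) :
    deriv (deriv (cosFn m j)) = fun t => -(Real.pi * m j) ^ 2 * cosFn m j t := by
  funext t
  have h : HasDerivAt (fun t : ℝ => Real.pi * m j * t) (Real.pi * m j) t := by
    simpa using (hasDerivAt_id t).const_mul (Real.pi * m j)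
  rw [deriv_cosFn, (h.sin.const_mul _).deriv, cosFn]
  ring

/-- The sine vanishes at both ends and is Lipschitz, and `min t (1 - t) ≤ 2 t (1 - t)`. This is the
decay that integration by parts demands. -/
theorem abs_sin_pi_mul_int_le (m : ℤ) {t : ℝ} (ht : t ∈ Set.Ioo (0 : ℝ) 1) :
    |Real.sin (Real.pi * m * t)| ≤ 2 * |Real.pi * m| * (t * (1 - t)) := by
  have h1 : |Real.sin (Real.pi * m * t)| ≤ |Real.pi * m| * t := by
    refine Real.abs_sin_le_abs.trans ?_
    rw [abs_mul, abs_of_pos ht.1]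
  have h2 : |Real.sin (Real.pi * m * t)| ≤ |Real.pi * m| * (1 - t) := by
    have h3 : Real.sin (Real.pi * m * t) =
        -(Real.cos (m * Real.pi) * Real.sin (Real.pi * m * (1 - t))) := by
      have h4 : Real.pi * m * t = m * Real.pi - Real.pi * m * (1 - t) := by ring
      rw [h4, Real.sin_sub, Real.sin_int_mul_pi]
      ring
    rw [h3, abs_neg, abs_mul]
    refine (mul_le_of_le_one_left (abs_nonneg _) (Real.abs_cos_le_one _)).trans ?_
    refine Real.abs_sin_le_abs.trans ?_
    rw [abs_mul, abs_of_pos (sub_pos.2 ht.2)]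
  have h0 := abs_nonneg (Real.pi * m)
  have ht1 := ht.1
  have ht2 := sub_pos.2 ht.2
  rcases le_total t (1 / 2) with h | h
  · refine h1.trans ?_
    have : t ≤ 2 * (t * (1 - t)) := by nlinarith
    nlinarith
  · refine h2.trans ?_
    have : 1 - t ≤ 2 * (t * (1 - t)) := by nlinarith
    nlinarith

theorem contDiff_prodFn_cosFn (m : Fin n → ℤ) : ContDiff ℝ ∞ (prodFn b p a (cosFn m)) :=
  contDiff_prodFn (contDiff_cosFn m)

/-- The product of cosines with frequencies `m`, as an element of `L²` of the open box. -/
noncomputable def cosLp (b : OrthonormalBasis (Fin n) ℝ (EuclideanSpace ℝ (Fin n)))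
    (p : EuclideanSpace ℝ (Fin n)) (ha : ∀ i, 0 < a i) (m : Fin n → ℤ) :
    L2 (interior (box b p a)) :=
  (memLp_of_continuous ha (contDiff_prodFn_cosFn m).continuous).toLp (prodFn b p a (cosFn m))

/-- The gradient of `cosLp`. -/
noncomputable def cosGrad (b : OrthonormalBasis (Fin n) ℝ (EuclideanSpace ℝ (Fin n)))
    (p : EuclideanSpace ℝ (Fin n)) (ha : ∀ i, 0 < a i) (m : Fin n → ℤ) :
    L2Field (interior (box b p a)) :=
  (memLp_of_continuous ha (continuous_gradient (contDiff_prodFn_cosFn m))).toLp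
    (gradient (prodFn b p a (cosFn m)))

theorem hasWeakGradient_cosLp (ha : ∀ i, 0 < a i) (m : Fin n → ℤ) :
    HasWeakGradient (interior (box b p a)) (cosLp b p ha m) (cosGrad b p ha m) :=
  hasWeakGradient_of_contDiff ha (contDiff_prodFn_cosFn m)

theorem coeFn_cosLp (ha : ∀ i, 0 < a i) (m : Fin n → ℤ) :
    cosLp b p ha m =ᵐ[volume.restrict (interior (box b p a))] prodFn b p a (cosFn m) :=
  MemLp.coeFn_toLp _

theorem coeFn_cosGrad (ha : ∀ i, 0 < a i) (m : Fin n → ℤ) :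
    cosGrad b p ha m =ᵐ[volume.restrict (interior (box b p a))]
      gradient (prodFn b p a (cosFn m)) :=
  MemLp.coeFn_toLp _

theorem inner_cosLp (ha : ∀ i, 0 < a i) (m : Fin n → ℤ) (v : L2 (interior (box b p a))) :
    inner ℝ (cosLp b p ha m) v =
      ∫ x in interior (box b p a), v x * prodFn b p a (cosFn m) x := by
  rw [L2.inner_def]
  refine integral_congr_ae ?_
  filter_upwards [coeFn_cosLp (b := b) (p := p) ha m] with x hx
  rw [hx]
  rfl

/-- The one-directional weak eigenvalue equation of a product of cosines. -/
theorem integral_inner_mul_fderiv_cos (ha : ∀ i, 0 < a i) {v : L2 (interior (box b p a))}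
    {h : L2Field (interior (box b p a))} (hvh : HasWeakGradient (interior (box b p a)) v h)
    (m : Fin n → ℤ) (i : Fin n) :
    ∫ x in interior (box b p a),
        inner ℝ (h x) (b i) * fderiv ℝ (prodFn b p a (cosFn m)) x (b i) =
      (Real.pi * m i / (2 * a i)) ^ 2 * inner ℝ (cosLp b p ha m) v := by
  have hai := ha i
  -- The `i`-th factor is the derivative of the cosine, a sine vanishing at both ends: this is the
  -- Neumann condition at work.
  have key := integral_mul_prodFn_deriv ha hvh
    (f := Function.update (cosFn m) i (deriv (cosFn m i))) (C := 2 * (Real.pi * m i) ^ 2)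
    (fun j => by
      rcases eq_or_ne j i with rfl | hj
      · rw [Function.update_self, deriv_cosFn]
        exact contDiff_const.mul (Real.contDiff_sin.comp (by fun_prop))
      · rw [Function.update_of_ne hj]
        exact contDiff_cosFn m j) i
    (fun t ht => by
      rw [Function.update_self, deriv_cosFn, abs_mul, abs_neg]
      calc |Real.pi * m i| * |Real.sin (Real.pi * m i * t)|
          ≤ |Real.pi * m i| * (2 * |Real.pi * m i| * (t * (1 - t))) := by
            gcongr; exact abs_sin_pi_mul_int_le _ ht
        _ = 2 * |Real.pi * m i| ^ 2 * (t * (1 - t)) := by ring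
        _ = _ := by rw [sq_abs])
  have hupd : ∀ x, prodFn b p a (Function.update
      (Function.update (cosFn m) i (deriv (cosFn m i))) i (deriv (deriv (cosFn m i)))) x =
      -(Real.pi * m i) ^ 2 * prodFn b p a (cosFn m) x := fun x => by
    rw [Function.update_idem, prodFn_update, deriv_deriv_cosFn, prodFn_eq_mul (cosFn m) i,
      mul_assoc]
  simp only [Function.update_self, hupd, mul_left_comm _ (-(Real.pi * m i) ^ 2),
    integral_const_mul] at key
  simp only [fderiv_prodFn fun j => (contDiff_cosFn m j).differentiable (by simp),
    mul_left_comm _ (2 * a i)⁻¹, integral_const_mul]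
  rw [inner_cosLp]
  field_simp
  linarith

theorem isNeumannEigenfunction_equation (ha : ∀ i, 0 < a i) {v : L2 (interior (box b p a))}
    {h : L2Field (interior (box b p a))} (hvh : HasWeakGradient (interior (box b p a)) v h)
    (m : Fin n → ℤ) :
    inner ℝ (cosGrad b p ha m) h =
      (∑ i, (Real.pi * m i / (2 * a i)) ^ 2) * inner ℝ (cosLp b p ha m) v := by
  rw [Finset.sum_mul, L2.inner_def]
  simp only [← integral_inner_mul_fderiv_cos ha hvh m]
  rw [← integral_finsetSum]
  · refine integral_congr_ae ?_
    filter_upwards [coeFn_cosGrad (b := b) (p := p) ha m] with x hx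
    simp only [hx]
    rw [← b.sum_inner_mul_inner]
    refine Finset.sum_congr rfl fun i _ => ?_
    rw [inner_gradient, real_inner_comm, mul_comm]
  · intro i _
    have h1 : MemLp (fun x => inner ℝ (h x) (b i)) 2
        (volume.restrict (interior (box b p a))) := (Lp.memLp h).inner_const (b i)
    have h2 : Continuous fun x => fderiv ℝ (prodFn b p a (cosFn m)) x (b i) :=
      ((contDiff_prodFn_cosFn m).continuous_fderiv (by simp)).clm_apply continuous_const
    exact h1.integrable_mul (memLp_of_continuous ha h2)

/-- The Dirichlet form in the single direction `b i` is symmetric, with eigenvalues proportional to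
`m i ^ 2`. Working one direction at a time separates frequencies even if their full eigenvalues
coincide. -/
theorem inner_cosLp_eq_zero (ha : ∀ i, 0 < a i) {m m' : Fin n → ℤ} {i : Fin n}
    (hi : m i ^ 2 ≠ m' i ^ 2) : inner ℝ (cosLp b p ha m) (cosLp b p ha m') = 0 := by
  have h1 := integral_inner_mul_fderiv_cos ha (hasWeakGradient_cosLp (b := b) (p := p) ha m') m i
  have h2 := integral_inner_mul_fderiv_cos ha (hasWeakGradient_cosLp (b := b) (p := p) ha m) m' i
  have h3 : ∫ x in interior (box b p a), inner ℝ (cosGrad b p ha m' x) (b i) *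
      fderiv ℝ (prodFn b p a (cosFn m)) x (b i) =
      ∫ x in interior (box b p a), inner ℝ (cosGrad b p ha m x) (b i) *
      fderiv ℝ (prodFn b p a (cosFn m')) x (b i) := by
    refine integral_congr_ae ?_
    filter_upwards [coeFn_cosGrad (b := b) (p := p) ha m, coeFn_cosGrad (b := b) (p := p) ha m']
      with x hx hx'
    rw [hx, hx', inner_gradient, inner_gradient, mul_comm]
  rw [h1, h2, real_inner_comm, ← sub_eq_zero, ← sub_mul] at h3
  rw [real_inner_comm]
  refine (mul_eq_zero.1 h3).resolve_left fun h => hi ?_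
  have hai := ha i
  have hpi := Real.pi_pos
  field_simp at h
  rw [mul_zero] at h
  have h5 : (m i : ℝ) ^ 2 = (m' i : ℝ) ^ 2 :=
    sub_eq_zero.1 ((mul_eq_zero.1 h).resolve_left (by positivity))
  exact_mod_cast h5

theorem cosLp_ne_zero (ha : ∀ i, 0 < a i) (m : Fin n → ℤ) : cosLp b p ha m ≠ 0 := by
  intro h
  have h1 : prodFn b p a (cosFn m) =ᵐ[volume.restrict (interior (box b p a))] 0 :=
    (coeFn_cosLp ha m).symm.trans (h ▸ Lp.coeFn_zero _ _ _)
  have h2 := Measure.eqOn_open_of_ae_eq h1 isOpen_interior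
    (contDiff_prodFn_cosFn m).continuous.continuousOn continuous_zero.continuousOn
  have hd : ∀ i, 0 < 4 * (|(m i : ℝ)| + 1) := fun i => by positivity
  -- At this point every phase `π mᵢ tᵢ` is less than `π / 2` in absolute value, so no cosine
  -- vanishes.
  have h3 : point b p a (fun i => 1 / (4 * (|(m i : ℝ)| + 1))) ∈ interior (box b p a) := by
    refine (mem_interior_box_iff ha).2 fun i => ?_
    rw [coord_point ha]
    refine ⟨by have := hd i; positivity, ?_⟩
    rw [div_lt_one (hd i)]
    linarith [abs_nonneg (m i : ℝ)]
  have h4 := h2 h3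
  revert h4
  refine Finset.prod_ne_zero_iff.2 fun i _ => ?_
  rw [coord_point ha, cosFn]
  have hpi := Real.pi_pos
  have h5 : |Real.pi * m i * (1 / (4 * (|(m i : ℝ)| + 1)))| < Real.pi / 2 := by
    rw [mul_one_div, abs_div, abs_mul, abs_of_pos hpi, abs_of_pos (hd i), div_lt_iff₀ (hd i)]
    nlinarith [abs_nonneg (m i : ℝ), mul_nonneg hpi.le (abs_nonneg (m i : ℝ))]
  exact (Real.cos_pos_of_mem_Ioo (abs_lt.1 h5)).ne'

theorem isNeumannEigenfunction_cosLp (ha : ∀ i, 0 < a i) (m : Fin n → ℤ) :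
    IsNeumannEigenfunction (interior (box b p a)) (∑ i, (Real.pi * m i / (2 * a i)) ^ 2)
      (cosLp b p ha m) :=
  ⟨cosLp_ne_zero ha m, cosGrad b p ha m, hasWeakGradient_cosLp ha m, fun _ _ hvh =>
    isNeumannEigenfunction_equation ha hvh m⟩

theorem linearIndependent_cosLp (ha : ∀ i, 0 < a i) :
    LinearIndependent ℝ fun m : Fin n → ℕ => cosLp b p ha fun i => (m i : ℤ) := by
  refine linearIndependent_of_ne_zero_of_inner_eq_zero (fun m => cosLp_ne_zero ha _) ?_
  intro m m' hmm
  obtain ⟨i, hi⟩ := Function.ne_iff.1 hmm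
  refine inner_cosLp_eq_zero ha (i := i) ?_
  exact_mod_cast fun h => hi (Nat.pow_left_injective two_ne_zero h)

end Orthotope

/-! ### Completeness of the cosine products. -/

namespace Orthotope

open Filter Topology

variable {n : ℕ} {b : OrthonormalBasis (Fin n) ℝ (EuclideanSpace ℝ (Fin n))}
  {p : EuclideanSpace ℝ (Fin n)} {a : Fin n → ℝ}

/-- The product of cosines with frequencies `m`, as a continuous function on the closed box. -/
noncomputable def cosMap (b : OrthonormalBasis (Fin n) ℝ (EuclideanSpace ℝ (Fin n)))
    (p : EuclideanSpace ℝ (Fin n)) (a : Fin n → ℝ) (m : Fin n → ℤ) : C(box b p a, ℝ) :=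
  ⟨fun x => prodFn b p a (cosFn m) x,
    (contDiff_prodFn_cosFn m).continuous.comp continuous_subtype_val⟩

theorem prodFn_cosFn_single (i : Fin n) (x : EuclideanSpace ℝ (Fin n)) :
    prodFn b p a (cosFn (Pi.single i 1)) x = Real.cos (Real.pi * coord b p a i x) := by
  rw [prodFn, Finset.prod_eq_single i]
  · simp [cosFn]
  · intro j _ hj
    simp [cosFn, Pi.single_eq_of_ne hj]
  · simp

theorem prodFn_cosFn_add_single (m : Fin n → ℤ) (i : Fin n) (e : ℤ)
    (x : EuclideanSpace ℝ (Fin n)) :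
    prodFn b p a (cosFn (m + Pi.single i e)) x =
      Real.cos (Real.pi * (m i + e) * coord b p a i x) *
        ∏ j ∈ Finset.univ.erase i, cosFn m j (coord b p a j x) := by
  rw [prodFn_eq_mul _ i]
  congr 1
  · simp [cosFn]
  · refine Finset.prod_congr rfl fun j hj => ?_
    simp [cosFn, Pi.single_eq_of_ne (Finset.ne_of_mem_erase hj)]

/-- Product-to-sum formula. It lowers a frequency as well as raising it, which is why integer
frequencies are convenient. -/
theorem cosMap_single_mul (m : Fin n → ℤ) (i : Fin n) :
    cosMap b p a (Pi.single i 1) * cosMap b p a m =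
      (1 / 2 : ℝ) • (cosMap b p a (m + Pi.single i 1) + cosMap b p a (m + Pi.single i (-1))) := by
  ext x
  change prodFn b p a (cosFn (Pi.single i 1)) x * prodFn b p a (cosFn m) x =
    (1 / 2 : ℝ) * (prodFn b p a (cosFn (m + Pi.single i 1)) x +
      prodFn b p a (cosFn (m + Pi.single i (-1))) x)
  rw [prodFn_cosFn_single, prodFn_cosFn_add_single, prodFn_cosFn_add_single,
    prodFn_eq_mul (cosFn m) i, cosFn]
  have h1 : Real.pi * ((m i : ℝ) + (1 : ℤ)) * coord b p a i x =
      Real.pi * m i * coord b p a i x + Real.pi * coord b p a i x := by push_cast; ring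
  have h2 : Real.pi * ((m i : ℝ) + (-1 : ℤ)) * coord b p a i x =
      Real.pi * m i * coord b p a i x - Real.pi * coord b p a i x := by push_cast; ring
  rw [h1, h2, Real.cos_add, Real.cos_sub]
  ring

theorem cosMap_zero : cosMap b p a 0 = 1 := by
  ext x
  simp [cosMap, prodFn, cosFn]

theorem adjoin_cosMap_subset_span :
    ∀ f ∈ Algebra.adjoin ℝ (Set.range fun i => cosMap b p a (Pi.single i 1)),
      f ∈ Submodule.span ℝ (Set.range (cosMap b p a)) := by
  intro f hf
  -- Stability of the span under multiplication by `f` is what passes through products in the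
  -- induction; `g = 1` recovers the claim.
  suffices h : ∀ g ∈ Submodule.span ℝ (Set.range (cosMap b p a)),
      f * g ∈ Submodule.span ℝ (Set.range (cosMap b p a)) by
    simpa using h 1 (cosMap_zero (b := b) ▸ Submodule.subset_span ⟨0, rfl⟩)
  induction hf using Algebra.adjoin_induction with
  | mem f hf =>
    obtain ⟨i, rfl⟩ := hf
    intro g hg
    induction hg using Submodule.span_induction with
    | mem g hg =>
      obtain ⟨m, rfl⟩ := hg
      rw [cosMap_single_mul]
      exact Submodule.smul_mem _ _ (Submodule.add_mem _ (Submodule.subset_span ⟨_, rfl⟩)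
        (Submodule.subset_span ⟨_, rfl⟩))
    | zero => simp
    | add g g' _ _ h h' => rw [mul_add]; exact Submodule.add_mem _ h h'
    | smul r g _ h => rw [mul_smul_comm]; exact Submodule.smul_mem _ _ h
  | algebraMap r =>
    intro g hg
    rw [← Algebra.smul_def]
    exact Submodule.smul_mem _ _ hg
  | add f f' _ _ h h' =>
    intro g hg
    rw [add_mul]
    exact Submodule.add_mem _ (h g hg) (h' g hg)
  | mul f f' _ _ h h' =>
    intro g hg
    rw [mul_assoc]
    exact h _ (h' g hg)

/-- Cosine is injective on `[0, π]`, so the generators already determine all coordinates. -/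
theorem separatesPoints_adjoin_cosMap (ha : ∀ i, 0 < a i) :
    (Algebra.adjoin ℝ (Set.range fun i => cosMap b p a (Pi.single i 1))).SeparatesPoints := by
  intro x y hxy
  obtain ⟨i, hi⟩ : ∃ i, coord b p a i x ≠ coord b p a i y := by
    by_contra! h
    exact hxy (Subtype.ext (coord_injective ha h))
  refine ⟨_, ⟨_, Algebra.subset_adjoin ⟨i, rfl⟩, rfl⟩, fun h => hi ?_⟩
  change prodFn b p a (cosFn (Pi.single i 1)) x = prodFn b p a (cosFn (Pi.single i 1)) y at h
  rw [prodFn_cosFn_single, prodFn_cosFn_single] at h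
  have hpi := Real.pi_pos
  have hmem : ∀ z : box b p a, Real.pi * coord b p a i z ∈ Set.Icc 0 Real.pi := fun z => by
    have hz := (mem_box_iff ha).1 z.2 i
    exact ⟨mul_nonneg hpi.le hz.1, mul_le_of_le_one_right hpi.le hz.2⟩
  exact mul_left_cancel₀ hpi.ne' (Real.injOn_cos (hmem x) (hmem y) h)

/-- The products of cosines are complete in `L²` of the box. -/
theorem eq_zero_of_inner_cosLp_eq_zero (ha : ∀ i, 0 < a i) {w : L2 (interior (box b p a))}
    (hw : ∀ m, inner ℝ (cosLp b p ha m) w = 0) : w = 0 := by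
  have hfin : IsFiniteMeasure (volume.restrict (interior (box b p a))) :=
    ⟨by simpa using volume_interior_box_lt_top ha⟩
  have hint : IntegrableOn w (interior (box b p a)) := (Lp.memLp w).integrable (by norm_num)
  have hcs : CompactSpace (box b p a) := isCompact_iff_compactSpace.1 (isCompact_box ha)
  have hwint : ∀ F : EuclideanSpace ℝ (Fin n) → ℝ, Continuous F →
      Integrable (fun x => w x * F x) (volume.restrict (interior (box b p a))) := fun F hF =>
    (Lp.memLp w).integrable_mul (memLp_of_continuous ha hF)
  have hspan : ∀ f ∈ Submodule.span ℝ (Set.range (cosMap b p a)),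
      ∃ F : EuclideanSpace ℝ (Fin n) → ℝ, Continuous F ∧ (∀ x : box b p a, f x = F x) ∧
        ∫ x in interior (box b p a), w x * F x = 0 := by
    intro f hf
    induction hf using Submodule.span_induction with
    | mem f hf =>
      obtain ⟨m, rfl⟩ := hf
      exact ⟨prodFn b p a (cosFn m), (contDiff_prodFn_cosFn m).continuous, fun _ => rfl,
        by rw [← inner_cosLp ha, hw]⟩
    | zero => exact ⟨0, continuous_zero, fun _ => rfl, by simp⟩
    | add f g _ _ hf hg =>
      obtain ⟨F, hF, hfF, hF0⟩ := hf
      obtain ⟨G, hG, hgG, hG0⟩ := hg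
      refine ⟨F + G, hF.add hG, fun x => by simp [hfF, hgG], ?_⟩
      simp only [Pi.add_apply, mul_add]
      rw [integral_add (hwint F hF) (hwint G hG), hF0, hG0, add_zero]
    | smul r f _ hf =>
      obtain ⟨F, hF, hfF, hF0⟩ := hf
      refine ⟨r • F, hF.const_smul r, fun x => by simp [hfF], ?_⟩
      simp only [Pi.smul_apply, smul_eq_mul, mul_left_comm _ r]
      rw [integral_const_mul, hF0, mul_zero]
  -- It suffices to test `w` against smooth compactly supported `g`, each uniformly approximated on
  -- the box by the span of cosines.
  have hae := isOpen_interior.ae_eq_zero_of_integral_contDiff_smul_eq_zero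
    hint.locallyIntegrableOn (μ := volume) ?_
  · rw [Lp.eq_zero_iff_ae_eq_zero]
    exact (ae_restrict_iff' isOpen_interior.measurableSet).2 hae
  · intro g hg _ hgU
    have h0 : ∫ x, g x • w x = ∫ x in interior (box b p a), w x * g x := by
      refine (setIntegral_eq_integral_of_forall_compl_eq_zero
        (s := interior (box b p a)) fun x hx => ?_).symm.trans ?_
      rotate_left
      · simp only [smul_eq_mul, mul_comm]
      · rw [image_eq_zero_of_notMem_tsupport fun h => hx (hgU h), zero_smul]
    rw [h0, ← abs_nonpos_iff]
    set I := ∫ x in interior (box b p a), |w x| with hI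
    have hI0 : 0 ≤ I := integral_nonneg fun _ => abs_nonneg _
    refine le_of_forall_pos_le_add fun ε hε => ?_
    -- The `+ 1` keeps the tolerance meaningful when `w` has zero `L¹` norm.
    obtain ⟨f, hf⟩ := ContinuousMap.exists_mem_subalgebra_near_continuous_of_separatesPoints _
      (separatesPoints_adjoin_cosMap (b := b) (p := p) ha) (fun x : box b p a => g x)
      (hg.continuous.comp continuous_subtype_val) (ε / (I + 1)) (by positivity)
    obtain ⟨F, hF, hfF, hF0⟩ := hspan f (adjoin_cosMap_subset_span _ f.2)
    have h1 : ∫ x in interior (box b p a), w x * g x =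
        ∫ x in interior (box b p a), w x * (g x - F x) := by
      simp only [mul_sub]
      rw [integral_sub (hwint g hg.continuous) (hwint F hF), hF0, sub_zero]
    rw [h1, zero_add]
    calc |∫ x in interior (box b p a), w x * (g x - F x)|
        ≤ ∫ x in interior (box b p a), |w x| * (ε / (I + 1)) := by
          rw [← Real.norm_eq_abs]
          refine norm_integral_le_of_norm_le (hint.abs.mul_const _) ?_
          filter_upwards [ae_restrict_mem isOpen_interior.measurableSet] with x hx
          rw [Real.norm_eq_abs, abs_mul]
          gcongr
          have := hf ⟨x, interior_subset hx⟩
          rw [hfF, Real.norm_eq_abs, abs_sub_comm] at this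
          exact this.le
      _ = I * (ε / (I + 1)) := integral_mul_const _ _
      _ ≤ ε := by
          rw [mul_div_assoc', div_le_iff₀ (by positivity)]
          nlinarith

/-! ### Upper bounds and positivity for the Neumann eigenvalues. -/

theorem eigenvalue_nonneg {U : Set (EuclideanSpace ℝ (Fin n))} {lam : ℝ} {u : L2 U}
    (h : IsNeumannEigenfunction U lam u) : 0 ≤ lam := by
  obtain ⟨hu, g, hg, heq⟩ := h
  have h1 := heq u g hg
  rw [real_inner_self_eq_norm_sq, real_inner_self_eq_norm_sq] at h1
  have h2 : 0 < ‖u‖ ^ 2 := by have := norm_pos_iff.2 hu; positivity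
  exact nonneg_of_mul_nonneg_left (h1 ▸ sq_nonneg ‖g‖) h2

/-- An eigenfunction whose eigenvalue is below the first nonzero one is constant. -/
theorem eq_smul_cosLp_zero (ha : ∀ i, 0 < a i) {u : L2 (interior (box b p a))} {lam : ℝ}
    (hu : IsNeumannEigenfunction (interior (box b p a)) lam u)
    (hlam : ∀ i, lam < (Real.pi / (2 * a i)) ^ 2) : ∃ c : ℝ, u = c • cosLp b p ha 0 := by
  obtain ⟨-, g, hg, heq⟩ := hu
  have h1 : ∀ m : Fin n → ℤ, m ≠ 0 → inner ℝ (cosLp b p ha m) u = 0 := by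
    intro m hm
    obtain ⟨i, hi⟩ := Function.ne_iff.1 hm
    have e1 := isNeumannEigenfunction_equation ha hg m
    have e2 := heq _ _ (hasWeakGradient_cosLp (b := b) (p := p) ha m)
    -- Both weak equations compute the same gradient pairing, so `u` is orthogonal to every cosine
    -- product whose eigenvalue is not `lam`.
    rw [real_inner_comm, e2, real_inner_comm, ← sub_eq_zero, ← sub_mul] at e1
    refine (mul_eq_zero.1 e1).resolve_left fun h => ?_
    have hm1 : (1 : ℝ) ≤ (m i : ℝ) ^ 2 := by
      have h0 : m i ≠ 0 := hi
      have h1 : 0 < m i ^ 2 := by positivity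
      exact_mod_cast h1
    have h2 : (Real.pi / (2 * a i)) ^ 2 ≤ (Real.pi * m i / (2 * a i)) ^ 2 := by
      rw [mul_div_right_comm, mul_pow]
      exact le_mul_of_one_le_right (sq_nonneg _) hm1
    have h3 := Finset.single_le_sum (f := fun i => (Real.pi * m i / (2 * a i)) ^ 2)
      (fun j _ => sq_nonneg _) (Finset.mem_univ i)
    have h4 := hlam i
    linarith
  set N : ℝ := inner ℝ (cosLp b p ha 0) (cosLp b p ha 0) with hN
  have hN0 : N ≠ 0 := inner_self_ne_zero.2 (cosLp_ne_zero ha 0)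
  -- The coefficient of the projection onto constants; the remainder is orthogonal to all cosines
  -- and vanishes by completeness.
  refine ⟨inner ℝ (cosLp b p ha 0) u / N, sub_eq_zero.1 (eq_zero_of_inner_cosLp_eq_zero ha ?_)⟩
  intro m
  rw [inner_sub_right, inner_smul_right]
  rcases eq_or_ne m 0 with rfl | hm
  · rw [← hN, div_mul_cancel₀ _ hN0, sub_self]
  · obtain ⟨i, hi⟩ := Function.ne_iff.1 hm
    rw [h1 m hm, inner_cosLp_eq_zero ha (i := i) (by simpa using hi), mul_zero, sub_zero]

theorem neumannEigenvalue_le (ha : ∀ i, 0 < a i) {l : ℕ} {t : ℝ} (s : Finset (Fin n → ℕ))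
    (hs : l + 1 ≤ s.card) (hst : ∀ m ∈ s, ∑ i, (Real.pi * m i / (2 * a i)) ^ 2 ≤ t) :
    neumannEigenvalue (interior (box b p a)) l ≤ t := by
  refine csInf_le ⟨0, ?_⟩ ?_
  · rintro r ⟨u, -, hu⟩
    obtain ⟨lam, hlam, h⟩ := hu 0
    exact (eigenvalue_nonneg h).trans hlam
  · let e : Fin (l + 1) → Fin n → ℕ := fun j => (s.equivFin.symm (Fin.castLE hs j) : Fin n → ℕ)
    have he : Function.Injective e :=
      Subtype.val_injective.comp (s.equivFin.symm.injective.comp (Fin.castLE_injective hs))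
    refine ⟨_, (linearIndependent_cosLp ha).comp e he, fun j => ⟨_, ?_,
      isNeumannEigenfunction_cosLp ha fun i => (e j i : ℤ)⟩⟩
    simpa using hst (e j) (Subtype.prop _)

/-- Below the least `(π / (2 aᵢ))²` all eigenfunctions are constant, so two independent ones, which
`l ≥ 1` supplies, cannot both lie there. -/
theorem neumannEigenvalue_pos (hn : 1 ≤ n) (ha : ∀ i, 0 < a i) {l : ℕ} (hl : 1 ≤ l) :
    0 < neumannEigenvalue (interior (box b p a)) l := by
  have : Nonempty (Fin n) := ⟨⟨0, hn⟩⟩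
  obtain ⟨i₀, -, hi₀⟩ := Finset.exists_min_image Finset.univ
    (fun i => (Real.pi / (2 * a i)) ^ 2) Finset.univ_nonempty
  have hpos : 0 < (Real.pi / (2 * a i₀)) ^ 2 := by
    have := ha i₀; have := Real.pi_pos; positivity
  -- Nonemptiness matters, since `sInf ∅ = 0`; frequencies `(j, …, j)` give `l + 1` independent
  -- eigenfunctions.
  refine hpos.trans_le (le_csInf ?_ ?_)
  · let e : Fin (l + 1) → Fin n → ℕ := fun j _ => j
    have he : Function.Injective e := fun j j' h => Fin.ext (congrFun h ⟨0, hn⟩)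
    refine ⟨∑ j, ∑ i, (Real.pi * ((e j i : ℤ) : ℝ) / (2 * a i)) ^ 2, _,
      (linearIndependent_cosLp ha).comp e he, fun j => ⟨_, ?_,
      isNeumannEigenfunction_cosLp ha fun i => (e j i : ℤ)⟩⟩
    exact Finset.single_le_sum
      (f := fun j => ∑ i, (Real.pi * ((e j i : ℤ) : ℝ) / (2 * a i)) ^ 2)
      (fun j _ => Finset.sum_nonneg fun i _ => sq_nonneg _) (Finset.mem_univ j)
  · rintro t ⟨u, hu, hlam⟩
    by_contra! ht
    have hconst : ∀ j, ∃ c : ℝ, u j = c • cosLp b p ha 0 := fun j => by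
      obtain ⟨lam, hle, h⟩ := hlam j
      exact eq_smul_cosLp_zero ha h fun i =>
        (hle.trans_lt ht).trans_le (hi₀ i (Finset.mem_univ i))
    obtain ⟨c, hc⟩ := hconst 0
    obtain ⟨d, hd⟩ := hconst (Fin.last l)
    have hne : (0 : Fin (l + 1)) ≠ Fin.last l := fun h => by
      have := congrArg Fin.val h
      simp at this
      omega
    have hli : LinearIndependent ℝ ![u 0, u (Fin.last l)] := by
      have hinj : Function.Injective ![0, Fin.last l] := by
        intro i j
        fin_cases i <;> fin_cases j <;> simp [hne, hne.symm]
      have h2 : u ∘ ![0, Fin.last l] = ![u 0, u (Fin.last l)] := by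
        funext i
        fin_cases i <;> rfl
      exact h2 ▸ hu.comp _ hinj
    have hpair := LinearIndependent.pair_iff.1 hli d (-c) (by
      rw [hc, hd, smul_smul, smul_smul, ← add_smul]
      simp [mul_comm])
    refine hu.ne_zero (Fin.last l) ?_
    rw [hd, hpair.1, zero_smul]

end Orthotope

/-! ### Grid partitions of the box and eigenvalue counting. -/

namespace Orthotope

variable {n : ℕ} {b : OrthonormalBasis (Fin n) ℝ (EuclideanSpace ℝ (Fin n))}
  {p : EuclideanSpace ℝ (Fin n)} {a : Fin n → ℝ}

/-- The cell with index `j` of the grid dividing the `i`-th edge of the box into `N i` parts. -/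
def cell (b : OrthonormalBasis (Fin n) ℝ (EuclideanSpace ℝ (Fin n)))
    (p : EuclideanSpace ℝ (Fin n)) (a : Fin n → ℝ) (N : Fin n → ℕ) (j : ∀ i, Fin (N i)) :
    Set (EuclideanSpace ℝ (Fin n)) :=
  {x | ∀ i, coord b p a i x ∈ Set.Icc ((j i : ℝ) / N i) (((j i : ℝ) + 1) / N i)}

theorem coord_add (i : Fin n) (x v : EuclideanSpace ℝ (Fin n)) :
    coord b p a i (x + v) = coord b p a i x + inner ℝ (b i) v / (2 * a i) := by
  rw [coord, coord, add_sub_right_comm, inner_add_right, ← add_div]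
  ring

theorem coord_add_smul_sub (ha : ∀ i, 0 < a i) (i : Fin n) (t : ℝ)
    (x y z : EuclideanSpace ℝ (Fin n)) :
    coord b p a i (z + t • (x - y)) =
      coord b p a i z + t * (coord b p a i x - coord b p a i y) := by
  have := ha i
  rw [coord_add, inner_smul_right, inner_sub_eq_coord (p := p) ha]
  field_simp

theorem convex_cell (ha : ∀ i, 0 < a i) (N : Fin n → ℕ) (j : ∀ i, Fin (N i)) :
    Convex ℝ (cell b p a N j) := by
  intro x hx y hy s t hs ht hst i
  have h : s • x + t • y = x + t • (y - x) := by
    rw [← eq_sub_iff_add_eq] at hst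
    rw [hst, sub_smul, one_smul, smul_sub]
    abel
  have h2 := (convex_Icc ((j i : ℝ) / N i) (((j i : ℝ) + 1) / N i)) (hx i) (hy i) hs ht hst
  rw [h, coord_add_smul_sub ha]
  convert h2 using 1
  rw [← eq_sub_iff_add_eq] at hst
  simp only [hst, smul_eq_mul]
  ring

theorem interior_cell_nonempty (ha : ∀ i, 0 < a i) (N : Fin n → ℕ) (j : ∀ i, Fin (N i)) :
    (interior (cell b p a N j)).Nonempty := by
  have hopen : IsOpen {x | ∀ i, coord b p a i x ∈
      Set.Ioo ((j i : ℝ) / N i) (((j i : ℝ) + 1) / N i)} := by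
    rw [Set.ofPred_forall]
    exact isOpen_iInter_of_finite fun i => isOpen_Ioo.preimage (continuous_coord i)
  have hsub : {x | ∀ i, coord b p a i x ∈
      Set.Ioo ((j i : ℝ) / N i) (((j i : ℝ) + 1) / N i)} ⊆ cell b p a N j :=
    fun x hx i => Set.Ioo_subset_Icc_self (hx i)
  refine ⟨point b p a fun i => ((j i : ℝ) + 1 / 2) / N i,
    interior_maximal hsub hopen fun i => ?_⟩
  have hN : (0 : ℝ) < N i := by exact_mod_cast (j i).pos
  rw [coord_point ha]
  constructor <;> gcongr <;> linarith

theorem exists_mem_Icc_div {N : ℕ} (hN : 0 < N) {t : ℝ} (ht : t ∈ Set.Icc (0 : ℝ) 1) :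
    ∃ j : Fin N, t ∈ Set.Icc ((j : ℝ) / N) (((j : ℝ) + 1) / N) := by
  have hN' : (0 : ℝ) < N := by exact_mod_cast hN
  -- The index is `⌈t N⌉ - 1`, which makes sense only for `t > 0`.
  rcases ht.1.eq_or_lt with rfl | h0
  · exact ⟨⟨0, hN⟩, by simp, by positivity⟩
  · obtain ⟨j, hj⟩ := Nat.exists_eq_succ_of_ne_zero (Nat.ceil_pos.2 (mul_pos h0 hN')).ne'
    have h1 : ⌈t * N⌉₊ ≤ N := Nat.ceil_le.2 (mul_le_of_le_one_left hN'.le ht.2)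
    have h2 : (j : ℝ) < t * N := Nat.lt_ceil.1 (by omega)
    have h3 : t * N ≤ j + 1 := by
      have := Nat.le_ceil (t * N)
      rw [hj] at this
      exact_mod_cast this
    exact ⟨⟨j, by omega⟩, (div_le_iff₀ hN').2 h2.le, (le_div_iff₀ hN').2 h3⟩

theorem iUnion_cell (ha : ∀ i, 0 < a i) {N : Fin n → ℕ} (hN : ∀ i, 0 < N i) :
    ⋃ j, cell b p a N j = box b p a := by
  ext x
  rw [Set.mem_iUnion, mem_box_iff ha]
  constructor
  · rintro ⟨j, hj⟩ i
    have hN' : (0 : ℝ) < N i := by exact_mod_cast hN i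
    have hji : (j i : ℝ) + 1 ≤ N i := by exact_mod_cast (j i).2
    exact ⟨le_trans (by positivity) (hj i).1, (hj i).2.trans ((div_le_one hN').2 hji)⟩
  · intro h
    choose j hj using fun i => exists_mem_Icc_div (hN i) (h i)
    exact ⟨j, hj⟩

theorem volume_coord_eq (ha : ∀ i, 0 < a i) (i : Fin n) (c : ℝ) :
    volume {x | coord b p a i x = c} = 0 := by
  let s : AffineSubspace ℝ (EuclideanSpace ℝ (Fin n)) :=
    { carrier := {x | coord b p a i x = c}
      smul_vsub_vadd_mem' := fun t x y z hx hy hz => by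
        change coord b p a i (t • (x - y) + z) = c
        rw [add_comm, coord_add_smul_sub ha, show coord b p a i x = c from hx,
          show coord b p a i y = c from hy, show coord b p a i z = c from hz]
        ring }
  refine Measure.addHaar_affineSubspace volume s fun h => ?_
  have h1 : point b p a (fun _ => c + 1) ∈ s := h ▸ AffineSubspace.mem_top ℝ _ _
  have h2 : coord b p a i (point b p a fun _ => c + 1) = c := h1
  rw [coord_point ha] at h2
  linarith

theorem volume_cell_inter_cell (ha : ∀ i, 0 < a i) {N : Fin n → ℕ} {j j' : ∀ i, Fin (N i)}
    (hjj : j ≠ j') : volume (cell b p a N j ∩ cell b p a N j') = 0 := by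
  obtain ⟨i, hi⟩ := Function.ne_iff.1 hjj
  wlog hlt : j i < j' i generalizing j j'
  · rw [Set.inter_comm]
    exact this hjj.symm hi.symm (lt_of_le_of_ne (not_lt.1 hlt) hi.symm)
  -- The common points lie on the hyperplane through the upper `i`-th face of the lower cell.
  refine measure_mono_null (fun x hx => ?_)
    (volume_coord_eq (b := b) (p := p) ha i (((j i : ℝ) + 1) / N i))
  refine le_antisymm (hx.1 i).2 (le_trans ?_ (hx.2 i).1)
  gcongr
  exact_mod_cast hlt

theorem isConvexPartition_cell (ha : ∀ i, 0 < a i) {N : Fin n → ℕ} (hN : ∀ i, 0 < N i) :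
    IsConvexPartition (box b p a) fun k => cell b p a N (finPiFinEquiv.symm k) where
  convex _ := convex_cell ha N _
  interior_nonempty _ := interior_cell_nonempty ha N _
  iUnion_eq := by
    rw [← iUnion_cell ha hN]
    exact finPiFinEquiv.symm.surjective.iUnion_comp (cell b p a N)
  volume_inter _ _ h := volume_cell_inter_cell ha (finPiFinEquiv.symm.injective.ne h)

theorem diam_cell_le (ha : ∀ i, 0 < a i) {N : Fin n → ℕ} {r : ℝ} (hr : 0 ≤ r)
    (hN : ∀ i, 2 * a i / N i ≤ r) (j : ∀ i, Fin (N i)) :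
    Metric.diam (cell b p a N j) ≤ √n * r := by
  refine Metric.diam_le_of_forall_dist_le (by positivity) fun x hx y hy => ?_
  rw [dist_eq_norm]
  refine abs_le_of_sq_le_sq' ?_ (by positivity) |>.2
  rw [mul_pow, Real.sq_sqrt (Nat.cast_nonneg n), ← b.sum_sq_norm_inner_right]
  calc ∑ i, ‖inner ℝ (b i) (x - y)‖ ^ 2 ≤ ∑ _i : Fin n, r ^ 2 := by
        refine Finset.sum_le_sum fun i _ => ?_
        have hai := ha i
        have h1 : |coord b p a i x - coord b p a i y| ≤ 1 / N i := by
          have h2 := hx i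
          have h3 := hy i
          rw [Set.mem_Icc, add_div] at h2 h3
          rw [abs_le]
          constructor <;> linarith [h2.1, h2.2, h3.1, h3.2]
        gcongr
        rw [inner_sub_eq_coord (p := p) ha, Real.norm_eq_abs, abs_mul, abs_of_pos (by positivity)]
        calc 2 * a i * |coord b p a i x - coord b p a i y| ≤ 2 * a i * (1 / N i) := by gcongr
          _ = 2 * a i / N i := by ring
          _ ≤ r := hN i
    _ = n * r ^ 2 := by simp

/-- A lower bound for the counting function of the Neumann eigenvalues of a box. -/
theorem prod_floor_add_one_le (ha : ∀ i, 0 < a i) {l : ℕ} {s : ℝ} (hs : 0 ≤ s)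
    (hlt : n * (Real.pi * s) ^ 2 < neumannEigenvalue (interior (box b p a)) l) :
    ∏ i, (⌊2 * a i * s⌋₊ + 1) ≤ l := by
  by_contra! h
  -- Otherwise the frequencies `0 ≤ mᵢ ≤ 2 aᵢ s` would give `l + 1` eigenvalues at most `n (π s)²`.
  refine hlt.not_ge (neumannEigenvalue_le ha
    (Fintype.piFinset fun i => Finset.range (⌊2 * a i * s⌋₊ + 1)) (by simpa using h) ?_)
  intro m hm
  rw [Fintype.mem_piFinset] at hm
  calc ∑ i, (Real.pi * m i / (2 * a i)) ^ 2 ≤ ∑ _i : Fin n, (Real.pi * s) ^ 2 := by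
        refine Finset.sum_le_sum fun i _ => ?_
        have hai := ha i
        have hpi := Real.pi_pos
        have h1 : (m i : ℝ) ≤ 2 * a i * s :=
          (Nat.le_floor_iff (by positivity)).1 (Nat.lt_succ_iff.1 (Finset.mem_range.1 (hm i)))
        gcongr
        rw [div_le_iff₀ (by positivity)]
        nlinarith
    _ = n * (Real.pi * s) ^ 2 := by simp

/-- The factor `1 / 2` pays for rounding up: if `x q / 2 ≥ 1` then `x q / 2 + 1 ≤ x q`, and
otherwise the ceiling is at most `1 ≤ q`. -/
theorem ceil_mul_half_le {x q : ℝ} (hx : 0 ≤ x) (hq : 1 ≤ q) :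
    (⌈x * q / 2⌉₊ : ℝ) ≤ q * (⌊x⌋₊ + 1) := by
  have h0 : (0 : ℝ) ≤ ⌊x⌋₊ := Nat.cast_nonneg _
  have h1 : x ≤ ⌊x⌋₊ + 1 := (Nat.lt_floor_add_one x).le
  rcases le_total (x * q / 2) 1 with h | h
  · have h2 : (⌈x * q / 2⌉₊ : ℝ) ≤ 1 := by
      exact_mod_cast Nat.ceil_le.2 (by exact_mod_cast h)
    nlinarith
  · have h2 := (Nat.ceil_lt_add_one (show 0 ≤ x * q / 2 by have := hx; positivity)).le
    nlinarith

end Orthotope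

/-! ### Choice of scale and conclusion. -/

open Orthotope

theorem lemma3p2 :
    ∃ c : ℝ, 0 < c ∧
      ∀ n : ℕ, 1 ≤ n → ∀ Ω : Set (EuclideanSpace ℝ (Fin n)), IsOrthotope Ω →
        ∀ k l : ℕ, 1 ≤ l → l ≤ k →
          ∃ k' : ℕ, k' ≤ k ∧ ∃ P : Fin k' → Set (EuclideanSpace ℝ (Fin n)),
            IsConvexPartition Ω P ∧
            ∀ i, Metric.diam (P i) ≤
              c * (n : ℝ) ^ (3 / 2 : ℝ) * ((l : ℝ) / (k : ℝ)) ^ (1 / (n : ℝ)) *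
                (1 / √(neumannEigenvalue (interior Ω) l)) := by
  refine ⟨4 * Real.pi, by positivity, ?_⟩
  rintro n hn Ω ⟨b, p, a, ha, rfl⟩ k l hl hlk
  change ∃ k' : ℕ, k' ≤ k ∧ ∃ P : Fin k' → Set (EuclideanSpace ℝ (Fin n)),
    IsConvexPartition (box b p a) P ∧ ∀ i, Metric.diam (P i) ≤
      4 * Real.pi * (n : ℝ) ^ (3 / 2 : ℝ) * ((l : ℝ) / (k : ℝ)) ^ (1 / (n : ℝ)) *
        (1 / √(neumannEigenvalue (interior (box b p a)) l))
  set μ := neumannEigenvalue (interior (box b p a)) l with hμdef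
  have hμ : 0 < μ := neumannEigenvalue_pos hn ha hl
  have hpi := Real.pi_pos
  have hn' : (1 : ℝ) ≤ n := by exact_mod_cast hn
  have hn0 : (0 : ℝ) < n := by linarith
  have hl' : (0 : ℝ) < l := by exact_mod_cast hl
  have hlk' : (l : ℝ) ≤ k := by exact_mod_cast hlk
  have hk' : (0 : ℝ) < k := hl'.trans_le hlk'
  have hsn : 0 < √(n : ℝ) := Real.sqrt_pos.2 hn0
  have hsμ : 0 < √μ := Real.sqrt_pos.2 hμ
  set s : ℝ := √μ / (2 * Real.pi * √n) with hs
  have hs0 : 0 < s := by positivity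
  set q : ℝ := ((k : ℝ) / l) ^ (1 / (n : ℝ)) with hq
  have hq1 : 1 ≤ q := Real.one_le_rpow ((one_le_div hl').2 hlk') (by positivity)
  have hq0 : 0 < q := by linarith
  have hqn : q ^ n = k / l := by
    rw [hq, ← Real.rpow_natCast, ← Real.rpow_mul (by positivity), one_div_mul_cancel hn0.ne',
      Real.rpow_one]
  have hqinv : ((l : ℝ) / k) ^ (1 / (n : ℝ)) = q⁻¹ := by
    rw [hq, ← Real.inv_rpow (by positivity), inv_div]
  have hcount : ∏ i, (⌊2 * a i * s⌋₊ + 1) ≤ l := by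
    refine prod_floor_add_one_le (b := b) (p := p) ha hs0.le ?_
    have h1 : n * (Real.pi * s) ^ 2 = μ / 4 := by
      rw [hs, mul_pow, div_pow, mul_pow, mul_pow, Real.sq_sqrt hμ.le, Real.sq_sqrt hn0.le]
      field_simp
      norm_num
    rw [h1]
    linarith
  set N : Fin n → ℕ := fun i => ⌈2 * a i * s * q / 2⌉₊ with hN
  have hx : ∀ i, 0 < 2 * a i * s * q / 2 := fun i => by have := ha i; positivity
  have hNpos : ∀ i, 0 < N i := fun i => Nat.ceil_pos.2 (hx i)
  refine ⟨∏ i, N i, ?_, _, isConvexPartition_cell ha hNpos, fun j => ?_⟩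
  · have h1 : ((∏ i, N i : ℕ) : ℝ) ≤ k := by
      calc ((∏ i, N i : ℕ) : ℝ) = ∏ i, (N i : ℝ) := by push_cast; rfl
        _ ≤ ∏ i, q * ((⌊2 * a i * s⌋₊ : ℝ) + 1) :=
            Finset.prod_le_prod (fun i _ => Nat.cast_nonneg _) fun i _ =>
              ceil_mul_half_le (by have := ha i; positivity) hq1
        _ = q ^ n * ((∏ i, (⌊2 * a i * s⌋₊ + 1) : ℕ) : ℝ) := by
            rw [Finset.prod_mul_distrib]
            simp
        _ ≤ (k / l) * l := by
            rw [hqn]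
            gcongr
        _ = k := by field_simp
    exact_mod_cast h1
  · refine (diam_cell_le ha (r := 2 / (s * q)) (by positivity) (fun i => ?_) _).trans ?_
    · have h1 : (0 : ℝ) < N i := by exact_mod_cast hNpos i
      have h2 : 2 * a i * s * q / 2 ≤ N i := Nat.le_ceil _
      rw [div_le_div_iff₀ h1 (by positivity)]
      linarith
    · have h1 : (n : ℝ) ≤ (n : ℝ) ^ (3 / 2 : ℝ) := by
        conv_lhs => rw [← Real.rpow_one (n : ℝ)]
        exact Real.rpow_le_rpow_of_exponent_le hn' (by norm_num)
      have h2 : √(n : ℝ) * (2 / (s * q)) = 4 * Real.pi * n * q⁻¹ * (1 / √μ) := by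
        have h3 : √(n : ℝ) * √n = n := Real.mul_self_sqrt hn0.le
        rw [hs, ← h3]
        field_simp
        norm_num
      rw [h2, hqinv]
      gcongr
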